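/- Let $n\ge 2$ and $t\ge 1$. A finite non-empty set $Y$ on the unit sphere $S^{n-1}\subset\mathbb{R}^n$ is a *spherical design of harmonic index $t$* if $\sum_{x\in Y}f(x)=0$ for every real homogeneous harmonic polynomial $f$ of degree $t$ in $n$ variables. Let $Q_{n,k}$ denote the Gegenbauer polynomial of degree $k$ normalized by $Q_{n,k}(1)=\binom{n+k-1}{n-1}-\binom{n+k-3}{n-1}$; equivalently $Q_{n,0}=1$, $Q_{n,1}(x)=nx$ and $\lambda_{k+2}Q_{n,k+2}(x)=xQ_{n,k+1}(x)-(1-\lambda_k)Q_{n,k}(x)$ for $k\ge 0$, where $\lambda_0=0$ and $\lambda_k=\frac{k}{n+2k-2}$ for $k\ge1$. Put $$c_{n,t}=-\min_{-1\le x\le 1}Q_{n,t}(x),\qquad b_{n,t}=1+\frac{Q_{n,t}(1)}{c_{n,t}}.$$ A spherical design $Y$ of harmonic index $t$ on $S^{n-1}$ is called *tight* if $|Y|=b_{n,t}$. Theorem. Let $e\ge 3$ be a fixed integer. Then: 1. There is an $N$ such that for every $n\ge N$ there is no tight spherical design of harmonic index $2e$ on $S^{n-1}$. 2. For every $n\ge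 3$, every tight spherical design $Y$ of harmonic index $2e$ on $S^{n-1}$ satisfies $\{x\cdot y : x,y\in Y,\ x\ne y\}\subseteq\{\alpha,-\alpha\}$ for some $\alpha>0$, and $|Y|\le \frac{n(n+1)}{2}$. 3. There is a constant $B_{2e}>0$, depending only on $e$, such that $\lim_{n\to\infty} b_{n,2e}/n^e=B_{2e}$. -/

import Mathlib

namespace HarmonicDesign

open scoped RealInnerProductSpace

/-- The formal Laplacian `∑ i, ∂²f/∂xᵢ²` of a real polynomial in `n` indeterminates. -/
noncomputable def laplacian {n : ℕ} (f : MvPolynomial (Fin n) ℝ) : MvPolynomial (Fin n) ℝ :=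
  ∑ i : Fin n, MvPolynomial.pderiv i (MvPolynomial.pderiv i f)

/-- `f` belongs to `Harm_k^n`: it is a real homogeneous harmonic polynomial of degree `k`
(or the zero polynomial). -/
def IsHarm {n : ℕ} (k : ℕ) (f : MvPolynomial (Fin n) ℝ) : Prop :=
  f.IsHomogeneous k ∧ laplacian f = 0

/-- `Y` is a (finite, non-empty) spherical design of harmonic index `t` on the unit sphere
of `ℝⁿ`. -/
structure IsDesignOfHarmonicIndex {n : ℕ} (t : ℕ) (Y : Finset (EuclideanSpace ℝ (Fin n))) :
    Prop where
  nonempty : Y.Nonempty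
  norm_eq_one : ∀ x ∈ Y, ‖x‖ = 1
  sum_eq_zero : ∀ f : MvPolynomial (Fin n) ℝ, IsHarm t f →
    ∑ x ∈ Y, MvPolynomial.eval (fun i => x i) f = 0

/-- The numbers `k / (n + 2k - 2)` of the three-term recurrence of the Gegenbauer polynomials
(with value `0` at `k = 0`). -/
noncomputable def gegenbauerCoeff (n k : ℕ) : ℝ :=
  (k : ℝ) / ((n : ℝ) + 2 * (k : ℝ) - 2)

/-- The Gegenbauer polynomials `Q_{n,k}`, normalized by `Q_{n,k}(1) = dim Harm_k^n`, through the
three-term recurrence of Delsarte, Goethals and Seidel: `Q_{n,0} = 1`, `Q_{n,1} = n x` and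
`λ_{k+2} Q_{n,k+2} = x Q_{n,k+1} - (1 - λ_k) Q_{n,k}` with `λ_k = k / (n + 2k - 2)`. -/
noncomputable def gegenbauerQ (n : ℕ) : ℕ → Polynomial ℝ
  | 0 => 1
  | 1 => Polynomial.C (n : ℝ) * Polynomial.X
  | k + 2 => Polynomial.C (gegenbauerCoeff n (k + 2))⁻¹ *
      (Polynomial.X * gegenbauerQ n (k + 1) -
        Polynomial.C (1 - gegenbauerCoeff n k) * gegenbauerQ n k)

/-- `c_{n,t} = - min_{-1 ≤ x ≤ 1} Q_{n,t}(x)`. -/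
noncomputable def minConst (n t : ℕ) : ℝ :=
  - sInf ((fun x : ℝ => (gegenbauerQ n t).eval x) '' Set.Icc (-1) 1)

/-- The infimum in the definition of `c_{n,t}` is attained, so it is a minimum. -/
theorem isLeast_neg_minConst (n t : ℕ) :
    IsLeast ((fun x : ℝ => (gegenbauerQ n t).eval x) '' Set.Icc (-1) 1) (- minConst n t) := by
  rw [minConst, neg_neg]
  exact (isCompact_Icc.image (gegenbauerQ n t).continuous).isLeast_sInf
    (Set.Nonempty.image _ ⟨0, by norm_num⟩)

/-- The Fisher type lower bound `b_{n,t} = 1 + Q_{n,t}(1) / c_{n,t}`. -/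
noncomputable def fisherBound (n t : ℕ) : ℝ :=
  1 + (gegenbauerQ n t).eval 1 / minConst n t

/-- `Y` is a tight spherical design of harmonic index `t`: a design of harmonic index `t` whose
size attains the Fisher type lower bound. -/
structure IsTightDesign {n : ℕ} (t : ℕ) (Y : Finset (EuclideanSpace ℝ (Fin n))) : Prop where
  isDesign : IsDesignOfHarmonicIndex t Y
  card_eq : (Y.card : ℝ) = fisherBound n t

/-- `I(Y)`, the set of inner products of two distinct points of `Y`. -/
def innerProducts {n : ℕ} (Y : Finset (EuclideanSpace ℝ (Fin n))) : Set ℝ :=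
  {r | ∃ x ∈ Y, ∃ y ∈ Y, x ≠ y ∧ ⟪x, y⟫ = r}

end HarmonicDesign

/-! ### Gegenbauer polynomials: ladder relations, differential equation, derivatives. -/

namespace HarmonicDesign

open Polynomial

/-! A tight design is a set of equiangular unit vectors, and such a set is too small once `n` is
large. For `x ∈ Y`, testing the design against the zonal harmonic with axis `x` gives `∑ y ∈ Y,
Q(x·y) = 0` with `Q = Q_{n,2e}`. Since `Q ≥ -c`, this forces `|Y| ≥ 1 + Q(1)/c`, and equality makes
every inner product of distinct points a minimizer of `Q` (`IsTightDesign.eval_inner`).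

The minimizers are exactly two points `±α` with `0 < α < 1` (`exists_unique_minimizer`): by the
Gegenbauer equation, Sonin's function `μQ² + (1 - x²)Q'²` is strictly increasing on `x ≥ 0`, so
critical values there grow in absolute value. Hence `Y` is equiangular, and independence of the
matrices `xxᵀ` gives `|Y| ≤ n(n+1)/2` (`card_le_of_inner_sq_eq`).

On the other hand `n^{-e} Q_{n,2e}(x/√n)` converges coefficientwise to a Hermite polynomial with
negative minimum `m`. The minima converge too (`tendsto_sInf_image`), so `c` is asymptotic to `-m
n^e`, while `Q(1)` is asymptotic to `n^{2e}/(2e)!`. Thus the Fisher bound grows like `n^e`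
(`tendsto_fisherBound_div`), which beats `n(n+1)/2` when `e ≥ 3`. -/

lemma gegenbauerCoeff_zero (n : ℕ) : gegenbauerCoeff n 0 = 0 := by simp [gegenbauerCoeff]

lemma gegenbauer_denom_pos {n : ℕ} (hn : 3 ≤ n) (k : ℕ) : 0 < (n : ℝ) + 2 * (k : ℝ) - 2 := by
  have : (3 : ℝ) ≤ n := by exact_mod_cast hn
  have : (0 : ℝ) ≤ k := k.cast_nonneg
  linarith

lemma gegenbauerCoeff_mul {n : ℕ} (hn : 3 ≤ n) (k : ℕ) :
    gegenbauerCoeff n k * ((n : ℝ) + 2 * k - 2) = k :=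
  div_mul_cancel₀ _ (gegenbauer_denom_pos hn k).ne'

lemma gegenbauerCoeff_succ_pos {n : ℕ} (hn : 3 ≤ n) (k : ℕ) : 0 < gegenbauerCoeff n (k + 1) :=
  div_pos (by positivity) (gegenbauer_denom_pos hn _)

lemma one_sub_gegenbauerCoeff_pos {n : ℕ} (hn : 3 ≤ n) (k : ℕ) :
    0 < 1 - gegenbauerCoeff n k := by
  have h := gegenbauer_denom_pos hn k
  have : (3 : ℝ) ≤ n := by exact_mod_cast hn
  have : (0 : ℝ) ≤ k := k.cast_nonneg
  rw [gegenbauerCoeff, sub_pos, div_lt_one h]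
  linarith

/-- The factor in the lowering relation of the Gegenbauer polynomials. -/
noncomputable def loweringCoeff (n k : ℕ) : ℝ :=
  (1 - gegenbauerCoeff n k) * ((n : ℝ) + 2 * k)

lemma loweringCoeff_pos {n : ℕ} (hn : 3 ≤ n) (k : ℕ) : 0 < loweringCoeff n k := by
  have : (3 : ℝ) ≤ n := by exact_mod_cast hn
  exact mul_pos (one_sub_gegenbauerCoeff_pos hn k) (by positivity)

/-- This and the next two identities match the coefficients in the induction steps of
`gegenbauerQ_lowering` and, for zonal polynomials, of `dirDeriv_zonal`. -/
lemma loweringCoeff_sub {n : ℕ} (hn : 3 ≤ n) (k : ℕ) :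
    loweringCoeff n k - 2 * (1 - gegenbauerCoeff n k) = n + k - 2 := by
  rw [loweringCoeff]
  linear_combination - gegenbauerCoeff_mul hn k

lemma mul_loweringCoeff {n : ℕ} (hn : 3 ≤ n) (k : ℕ) :
    (1 - gegenbauerCoeff n (k + 1)) * loweringCoeff n k =
      (n + k - 1) * (1 - gegenbauerCoeff n k) := by
  have h := gegenbauerCoeff_mul hn (k + 1)
  rw [loweringCoeff]
  push_cast at h
  linear_combination - (1 - gegenbauerCoeff n k) * h

lemma gegenbauerCoeff_mul_loweringCoeff {n : ℕ} (hn : 3 ≤ n) (k : ℕ) :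
    gegenbauerCoeff n (k + 2) * loweringCoeff n (k + 1) =
      1 + (n + k - 2) * gegenbauerCoeff n (k + 1) := by
  have h := (gegenbauer_denom_pos hn (k + 2)).ne'
  have h' := (gegenbauer_denom_pos hn (k + 1)).ne'
  have q : (n : ℝ) + 2 * k ≠ 0 := by push_cast at h'; convert h' using 1; ring
  have q' : (n : ℝ) + 2 * k + 2 ≠ 0 := by push_cast at h; convert h using 1; ring
  have e : gegenbauerCoeff n (k + 2) = (k + 2) / (n + 2 * k + 2) := by
    rw [gegenbauerCoeff]; push_cast; congr 1; ring
  have e' : gegenbauerCoeff n (k + 1) = (k + 1) / (n + 2 * k) := by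
    rw [gegenbauerCoeff]; push_cast; congr 1; ring
  rw [loweringCoeff, e, e']
  push_cast
  field_simp
  ring

lemma mul_gegenbauerQ_add_two {n : ℕ} (hn : 3 ≤ n) (k : ℕ) :
    C (gegenbauerCoeff n (k + 2)) * gegenbauerQ n (k + 2) =
      X * gegenbauerQ n (k + 1) - C (1 - gegenbauerCoeff n k) * gegenbauerQ n k := by
  rw [gegenbauerQ, ← mul_assoc, ← C_mul,
    mul_inv_cancel₀ (gegenbauerCoeff_succ_pos hn (k + 1)).ne', C_1, one_mul]

lemma eval_gegenbauerQ_add_two {n : ℕ} (hn : 3 ≤ n) (k : ℕ) (x : ℝ) :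
    gegenbauerCoeff n (k + 2) * (gegenbauerQ n (k + 2)).eval x =
      x * (gegenbauerQ n (k + 1)).eval x -
        (1 - gegenbauerCoeff n k) * (gegenbauerQ n k).eval x := by
  simpa using congrArg (eval x) (mul_gegenbauerQ_add_two hn k)

lemma eval_derivative_gegenbauerQ_add_two {n : ℕ} (hn : 3 ≤ n) (k : ℕ) (x : ℝ) :
    gegenbauerCoeff n (k + 2) * (derivative (gegenbauerQ n (k + 2))).eval x =
      (gegenbauerQ n (k + 1)).eval x + x * (derivative (gegenbauerQ n (k + 1))).eval x -
        (1 - gegenbauerCoeff n k) * (derivative (gegenbauerQ n k)).eval x := by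
  have := congrArg (fun p => eval x (derivative p)) (mul_gegenbauerQ_add_two hn k)
  simpa [derivative_mul] using this

/-- The lowering relation `(1 - x²) Q_{k+1}' + (k+1) x Q_{k+1} = c_k Q_k`. -/
theorem gegenbauerQ_lowering {n : ℕ} (hn : 3 ≤ n) (x : ℝ) : ∀ k : ℕ,
    (1 - x ^ 2) * (derivative (gegenbauerQ n (k + 1))).eval x +
      (k + 1) * x * (gegenbauerQ n (k + 1)).eval x =
        loweringCoeff n k * (gegenbauerQ n k).eval x
  | 0 => by
    simp [gegenbauerQ, loweringCoeff, gegenbauerCoeff]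
    ring
  | 1 => by
    have h0 := eval_gegenbauerQ_add_two hn 0 x
    have h1 := eval_derivative_gegenbauerQ_add_two hn 0 x
    have hk := gegenbauerCoeff_mul_loweringCoeff hn 0
    have h2 := gegenbauerCoeff_mul hn 1
    apply mul_left_cancel₀ (gegenbauerCoeff_succ_pos hn 1).ne'
    have a0 : (gegenbauerQ n 0).eval x = 1 := by simp [gegenbauerQ]
    have a1 : (gegenbauerQ n 1).eval x = n * x := by simp [gegenbauerQ]
    have b0 : (derivative (gegenbauerQ n 0)).eval x = 0 := by simp [gegenbauerQ]
    have b1 : (derivative (gegenbauerQ n 1)).eval x = n := by simp [gegenbauerQ]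
    have l0 := gegenbauerCoeff_zero n
    simp only [zero_add] at *
    rw [a0, a1, l0] at h0
    rw [a1, b1, b0] at h1
    rw [a1]
    push_cast at *
    linear_combination (1 - x ^ 2) * h1 + 2 * x * h0 - n * x * hk - n * x * h2 + 2 * x * h2
  | k + 2 => by
    have ih0 := gegenbauerQ_lowering hn x k
    have ih1 := gegenbauerQ_lowering hn x (k + 1)
    have h0 := eval_gegenbauerQ_add_two hn (k + 1) x
    have h1 := eval_derivative_gegenbauerQ_add_two hn (k + 1) x
    have h2 := eval_gegenbauerQ_add_two hn k x
    have e1 := loweringCoeff_sub hn (k + 1)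
    have e2 := mul_loweringCoeff hn k
    have e3 := gegenbauerCoeff_mul_loweringCoeff hn (k + 1)
    apply mul_left_cancel₀ (gegenbauerCoeff_succ_pos hn (k + 2)).ne'
    simp only [add_assoc, Nat.reduceAdd] at *
    push_cast at *
    linear_combination (1 - x ^ 2) * h1 + (k + 3) * x * h0 + x * ih1
      - (1 - gegenbauerCoeff n (k + 1)) * ih0
      + x * (gegenbauerQ n (k + 1)).eval x * e1 - (gegenbauerQ n k).eval x * e2
      - (gegenbauerQ n (k + 2)).eval x * e3 - (n + k - 1) * h2

/-- The raising relation. -/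
theorem gegenbauerQ_raising {n : ℕ} (hn : 3 ≤ n) (x : ℝ) (k : ℕ) :
    (1 - x ^ 2) * (derivative (gegenbauerQ n k)).eval x =
      (n + k - 2) * x * (gegenbauerQ n k).eval x -
        (n + 2 * k - 2) * gegenbauerCoeff n (k + 1) * (gegenbauerQ n (k + 1)).eval x := by
  cases k with
  | zero =>
    have : (n : ℝ) ≠ 0 := by positivity
    have : (n : ℝ) + 2 - 2 ≠ 0 := by simpa
    simp [gegenbauerQ, gegenbauerCoeff]
    field_simp
    ring
  | succ k =>
    have h0 := gegenbauerQ_lowering hn x k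
    have h1 := eval_gegenbauerQ_add_two hn k x
    rw [loweringCoeff] at h0
    push_cast
    linear_combination h0 + (n + 2 * k) * h1

lemma raising_mul_lowering {n : ℕ} (hn : 3 ≤ n) (k : ℕ) :
    ((n : ℝ) + 2 * k - 2) * gegenbauerCoeff n (k + 1) * loweringCoeff n k =
      (k + 1) * (n + k - 2) := by
  have h := gegenbauerCoeff_mul hn k
  have h' := gegenbauerCoeff_mul hn (k + 1)
  rw [loweringCoeff]
  push_cast at h'
  linear_combination ((n : ℝ) + 2 * k - 2) * (1 - gegenbauerCoeff n k) * h' - (k + 1) * h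

lemma one_sub_X_sq_ne_zero : (1 - X ^ 2 : ℝ[X]) ≠ 0 := by
  intro h
  simpa using congrArg (eval 0) h

/-- The Gegenbauer differential equation. -/
theorem gegenbauerQ_ode {n : ℕ} (hn : 3 ≤ n) (k : ℕ) (x : ℝ) :
    (1 - x ^ 2) * (derivative (derivative (gegenbauerQ n k))).eval x -
      (n - 1) * x * (derivative (gegenbauerQ n k)).eval x +
        k * (n + k - 2) * (gegenbauerQ n k).eval x = 0 := by
  have hp : (1 - X ^ 2) * derivative (gegenbauerQ n k) =
      C ((n : ℝ) + k - 2) * X * gegenbauerQ n k -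
        C (((n : ℝ) + 2 * k - 2) * gegenbauerCoeff n (k + 1)) * gegenbauerQ n (k + 1) := by
    refine Polynomial.funext fun x => ?_
    simpa using gegenbauerQ_raising hn x k
  suffices h : (1 - X ^ 2) * derivative (derivative (gegenbauerQ n k)) -
      C ((n : ℝ) - 1) * X * derivative (gegenbauerQ n k) +
        C (k * ((n : ℝ) + k - 2)) * gegenbauerQ n k = 0 by
    simpa using congrArg (eval x) h
  -- After multiplication by `1 - x²`, differentiate the raising relation, then replace `Q_{k+1}'`
  -- by lowering and `Q_{k+1}` by raising; the constants meet in `raising_mul_lowering`.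
  apply mul_left_cancel₀ one_sub_X_sq_ne_zero
  refine Polynomial.funext fun x => ?_
  have h0 := congrArg (fun p => eval x (derivative p)) hp
  simp only [derivative_mul, derivative_sub, derivative_one, derivative_X_pow, derivative_C,
    derivative_X, eval_mul, eval_sub, eval_add, eval_one, eval_pow, eval_X, eval_C, eval_zero]
    at h0 ⊢
  norm_num at h0
  have h1 := gegenbauerQ_raising hn x k
  have h2 := gegenbauerQ_lowering hn x k
  have h3 := raising_mul_lowering hn k
  linear_combination (1 - x ^ 2) * h0
    - ((n : ℝ) + 2 * k - 2) * gegenbauerCoeff n (k + 1) * h2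
    - (gegenbauerQ n k).eval x * h3 + (k + 1) * x * h1

/-- Lowering from degree `k + 2` and raising from degree `k` both express `(1 - x²)Q'` through
neighbouring `Q`'s; the three-term recurrence removes the rest. -/
lemma gegenbauerQ_derivative_add_two {n : ℕ} (hn : 3 ≤ n) (k : ℕ) :
    C ((n : ℝ) + 2 * k - 2) * derivative (gegenbauerQ n (k + 2)) =
      C ((n : ℝ) + 2 * k + 2) * (C ((n : ℝ) + 2 * k - 2) * gegenbauerQ n (k + 1) +
        derivative (gegenbauerQ n k)) := by
  apply mul_left_cancel₀ one_sub_X_sq_ne_zero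
  refine Polynomial.funext fun x => ?_
  have h1 := gegenbauerQ_lowering hn x (k + 1)
  have h2 := gegenbauerQ_raising hn x k
  have h3 := eval_gegenbauerQ_add_two hn k x
  have e := gegenbauerCoeff_mul hn (k + 2)
  have e' := gegenbauerCoeff_mul hn k
  rw [loweringCoeff] at h1
  simp only [eval_mul, eval_sub, eval_add, eval_one, eval_pow, eval_X, eval_C]
  push_cast at h1 e
  linear_combination ((n : ℝ) + 2 * k - 2) * h1 - ((n : ℝ) + 2 * k + 2) * h2
    - ((n : ℝ) + 2 * k - 2) * ((n : ℝ) + 2 * k + 2) * x * h3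
    + ((n : ℝ) + 2 * k - 2) * x * (gegenbauerQ n (k + 2)).eval x * e
    - x * (gegenbauerQ n k).eval x * ((n : ℝ) + 2 * k + 2) * e'

/-- The derivative of a Gegenbauer polynomial is a multiple of one in dimension `n + 2`. -/
theorem derivative_gegenbauerQ {n : ℕ} (hn : 3 ≤ n) : ∀ k : ℕ,
    derivative (gegenbauerQ n (k + 1)) = C (n : ℝ) * gegenbauerQ (n + 2) k
  | 0 => by simp [gegenbauerQ]
  | 1 => by
    have h := gegenbauerQ_derivative_add_two hn 0
    have h0 := gegenbauer_denom_pos hn 0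
    simp only [Nat.cast_zero, mul_zero, add_zero, zero_add] at h h0
    apply mul_left_cancel₀ (C_ne_zero.mpr h0.ne')
    rw [h]
    simp [gegenbauerQ]
    ring
  | k + 2 => by
    have ih0 := derivative_gegenbauerQ hn k
    have ih1 := derivative_gegenbauerQ hn (k + 1)
    refine Polynomial.funext fun x => ?_
    have h := congrArg (eval x) (gegenbauerQ_derivative_add_two hn (k + 1))
    have h1 := eval_derivative_gegenbauerQ_add_two hn (k + 1) x
    have h2 := eval_gegenbauerQ_add_two (n := n + 2) (by lia) k x
    rw [ih0] at h1 h
    rw [ih1] at h1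
    have e3 := gegenbauerCoeff_mul hn (k + 3)
    have e1 := gegenbauerCoeff_mul hn (k + 1)
    have e2 := gegenbauerCoeff_mul (n := n + 2) (by lia) (k + 2)
    have e0 := gegenbauerCoeff_mul (n := n + 2) (by lia) k
    -- Eliminating `Q_{k+2}` between `h1` and `h` leaves a three-term recurrence for the
    -- derivatives, that of dimension `n + 2`, with this factor in front of the top term.
    have hpos : ((k : ℝ) + 2) * (n + 2 * k) ≠ 0 := by positivity
    apply mul_left_cancel₀ hpos
    simp only [eval_mul, eval_C, eval_add] at h h1 ⊢
    push_cast at *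
    linear_combination ((n : ℝ) + 2 * k) * (n + 2 * k + 4) * h1 - h
      - n * ((n : ℝ) + 2 * k) * (n + 2 * k + 4) * h2
      - ((n : ℝ) + 2 * k) * (derivative (gegenbauerQ n (k + 3))).eval x * e3
      + n * ((n : ℝ) + 2 * k) * (gegenbauerQ (n + 2) (k + 2)).eval x * e2
      + (n + 2 * k + 4) * n * (gegenbauerQ (n + 2) k).eval x * (e1 - e0)

end HarmonicDesign

/-! ### Zeros, sign pattern and minimizers of `Q_{n,2e}`. -/

namespace HarmonicDesign

open Polynomial

/-- At `x = 1` the derivative term of the lowering relation vanishes. -/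
lemma gegenbauerQ_eval_one_pos {n : ℕ} (hn : 3 ≤ n) (k : ℕ) : 0 < (gegenbauerQ n k).eval 1 := by
  induction k with
  | zero => simp [gegenbauerQ]
  | succ k ih =>
    have h := gegenbauerQ_lowering hn 1 k
    have h' := mul_pos (loweringCoeff_pos hn k) ih
    rw [← h] at h'
    have hk : (0 : ℝ) < k + 1 := by positivity
    simp only [one_pow, sub_self, zero_mul, zero_add, mul_one] at h'
    exact pos_of_mul_pos_right h' hk.le

lemma gegenbauerQ_eval_neg (n k : ℕ) (x : ℝ) :
    (gegenbauerQ n k).eval (-x) = (-1) ^ k * (gegenbauerQ n k).eval x := by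
  induction k using Nat.twoStepInduction with
  | zero => simp [gegenbauerQ]
  | one => simp [gegenbauerQ]
  | more k h0 h1 =>
    simp only [gegenbauerQ, eval_mul, eval_C, eval_sub, eval_X, h0, h1]
    ring

lemma gegenbauerQ_two_mul_eval_neg (n e : ℕ) (x : ℝ) :
    (gegenbauerQ n (2 * e)).eval (-x) = (gegenbauerQ n (2 * e)).eval x := by
  simp [gegenbauerQ_eval_neg]

/-- A continuous function with a zero or a negative value left of a point where it is positive has
a last zero before that point. -/
lemma exists_last_zero {f : ℝ → ℝ} (hf : Continuous f) {a b : ℝ} (hab : a ≤ b) (ha : f a ≤ 0)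
    (hb : 0 < f b) : ∃ z, a ≤ z ∧ z < b ∧ f z = 0 ∧ ∀ x, z < x → x ≤ b → 0 < f x := by
  set S : Set ℝ := Set.Icc a b ∩ {x | f x ≤ 0} with hS
  have hc : IsCompact S := isCompact_Icc.inter_right (isClosed_le hf continuous_const)
  obtain ⟨z, ⟨⟨haz, hzb⟩, hz⟩, hmax⟩ := hc.exists_isGreatest ⟨a, ⟨le_rfl, hab⟩, ha⟩
  have hpos : ∀ x, z < x → x ≤ b → 0 < f x := by
    intro x hzx hxb
    by_contra! h
    exact absurd (hmax ⟨⟨haz.trans hzx.le, hxb⟩, h⟩) (not_le.mpr hzx)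
  have hzb' : z < b := lt_of_le_of_ne hzb (by rintro rfl; exact absurd hb (not_lt.mpr hz))
  refine ⟨z, haz, hzb', le_antisymm hz ?_, hpos⟩
  obtain ⟨w, hw, hw0⟩ := intermediate_value_Icc hzb hf.continuousOn
    (show (0 : ℝ) ∈ Set.Icc (f z) (f b) from ⟨hz, hb.le⟩)
  rcases hw.1.eq_or_lt with h | h
  · rw [h, hw0]
  · exact absurd (hpos w h hw.2) (by simp [hw0])

/-- Interlacing of the largest zeros for a sequence of functions with a three-term recurrence. -/
theorem exists_last_zero_of_recurrence {p : ℕ → ℝ → ℝ} {a b : ℕ → ℝ} {K : ℕ} {M : ℝ}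
    (hM : 0 ≤ M) (hc : ∀ k, Continuous (p k)) (ha : ∀ k, 0 < a k) (hb : ∀ k, 0 < b k)
    (hrec : ∀ k x, a k * p (k + 2) x = x * p (k + 1) x - b k * p k x)
    (h0 : ∀ x, 0 < p 0 x) (h1 : p 1 0 = 0) (h1' : ∀ x, 0 < x → 0 < p 1 x)
    (hpos : ∀ k ≤ K, 0 < p k M) (k : ℕ) (hk : k + 1 ≤ K) :
    ∃ z, 0 ≤ z ∧ (0 < k → 0 < z) ∧ z < M ∧ p (k + 1) z = 0 ∧
      (∀ x, z < x → x ≤ M → 0 < p (k + 1) x) ∧ p (k + 2) z < 0 := by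
  have key : ∀ k z, p (k + 1) z = 0 → 0 < p k z → p (k + 2) z < 0 := by
    intro k z hz hp
    have h := hrec k z
    rw [hz, mul_zero, zero_sub] at h
    by_contra! hcon
    have h3 := mul_nonneg (ha k).le hcon
    have h4 := mul_pos (hb k) hp
    linarith
  induction k with
  | zero =>
    refine ⟨0, le_rfl, fun h => absurd h (lt_irrefl 0), ?_, h1, fun x hx _ => h1' x hx,
      key 0 0 h1 (h0 0)⟩
    rcases hM.eq_or_lt with h | h
    · have := hpos 1 hk
      rw [← h, h1] at this
      exact absurd this (lt_irrefl 0)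
    · exact h
  | succ k ih =>
    obtain ⟨z, hz0, -, hzM, -, hzpos, hneg⟩ := ih (by lia)
    -- The negative value at `z` and the positive one at `M` force a zero to the right of `z`, where
    -- `p (k + 1)` is positive, so `key` applies again.
    obtain ⟨w, hzw, hwM, hw, hwpos⟩ :=
      exists_last_zero (hc (k + 2)) hzM.le hneg.le (hpos (k + 2) hk)
    have hlt : z < w := lt_of_le_of_ne hzw (by rintro rfl; exact absurd hw hneg.ne)
    exact ⟨w, by linarith, fun _ => by linarith, hwM, hw, hwpos,
      key (k + 1) w hw (hzpos w hlt hwM.le)⟩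

lemma gegenbauerQ_last_zero {n : ℕ} (hn : 3 ≤ n) (k : ℕ) :
    ∃ z, 0 ≤ z ∧ (0 < k → 0 < z) ∧ z < 1 ∧ (gegenbauerQ n (k + 1)).eval z = 0 ∧
      (∀ x, z < x → x ≤ 1 → 0 < (gegenbauerQ n (k + 1)).eval x) ∧
        (gegenbauerQ n (k + 2)).eval z < 0 := by
  have hn0 : (0 : ℝ) < n := by positivity
  exact exists_last_zero_of_recurrence (K := k + 1) (p := fun k x => (gegenbauerQ n k).eval x)
    zero_le_one (fun k => (gegenbauerQ n k).continuous)
    (fun k => gegenbauerCoeff_succ_pos hn (k + 1)) (fun k => one_sub_gegenbauerCoeff_pos hn k)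
    (fun k x => eval_gegenbauerQ_add_two hn k x) (by simp [gegenbauerQ]) (by simp [gegenbauerQ])
    (fun x hx => by simpa [gegenbauerQ] using mul_pos hn0 hx)
    (fun k _ => gegenbauerQ_eval_one_pos hn k) k le_rfl

lemma neg_minConst_le {n t : ℕ} {x : ℝ} (hx : x ∈ Set.Icc (-1 : ℝ) 1) :
    - minConst n t ≤ (gegenbauerQ n t).eval x :=
  (isLeast_neg_minConst n t).2 ⟨x, hx, rfl⟩

/-- The last zero of `Q_{k+1}` is a point where `Q_{k+2}` is negative. -/
lemma minConst_pos {n : ℕ} (hn : 3 ≤ n) (k : ℕ) : 0 < minConst n (k + 2) := by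
  obtain ⟨z, hz0, -, hz1, -, -, hneg⟩ := gegenbauerQ_last_zero hn k
  have := neg_minConst_le (n := n) (t := k + 2) (x := z) ⟨by linarith, hz1.le⟩
  linarith

/-- Sonin's function of a Gegenbauer polynomial. -/
noncomputable def sonin (n k : ℕ) : ℝ[X] :=
  C (k * ((n : ℝ) + k - 2)) * gegenbauerQ n k ^ 2 +
    (1 - X ^ 2) * derivative (gegenbauerQ n k) ^ 2

/-- The differential equation cancels `Q''` and the mixed term `Q Q'`. -/
lemma derivative_sonin {n : ℕ} (hn : 3 ≤ n) (k : ℕ) :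
    derivative (sonin n k) =
      C (2 * ((n : ℝ) - 2)) * (X * derivative (gegenbauerQ n k) ^ 2) := by
  refine Polynomial.funext fun x => ?_
  have h := gegenbauerQ_ode hn k x
  simp only [sonin, derivative_add, derivative_mul, derivative_sub, derivative_one, derivative_pow,
    derivative_C, derivative_X, eval_mul, eval_sub, eval_add, eval_one, eval_pow, eval_X, eval_C,
    eval_zero]
  norm_num
  linear_combination 2 * (derivative (gegenbauerQ n k)).eval x * h

lemma sonin_strictMonoOn {n : ℕ} (hn : 3 ≤ n) (k : ℕ) :
    StrictMonoOn (fun x => (sonin n (k + 1)).eval x) (Set.Ici 0) := by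
  have h3 : (3 : ℝ) ≤ n := by exact_mod_cast hn
  have hmono : MonotoneOn (fun x => (sonin n (k + 1)).eval x) (Set.Ici 0) := by
    refine monotoneOn_of_deriv_nonneg (convex_Ici 0) (sonin n (k + 1)).continuous.continuousOn
      (sonin n (k + 1)).differentiable.differentiableOn fun x hx => ?_
    rw [interior_Ici] at hx
    rw [Polynomial.deriv, derivative_sonin hn]
    simp only [eval_mul, eval_C, eval_X, eval_pow]
    have : 0 < x := hx
    have : (0 : ℝ) ≤ 2 * (n - 2) := by linarith
    positivity
  intro a ha b hb hab
  refine lt_of_le_of_ne (hmono ha hb hab.le) fun heq => ?_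
  -- Equal values at `a < b` would make the polynomial constant, yet its derivative at `1` is
  -- positive.
  have hconst : sonin n (k + 1) = C ((sonin n (k + 1)).eval a) := by
    refine Polynomial.eq_of_infinite_eval_eq _ _ ((Set.Icc_infinite hab).mono fun x hx => ?_)
    have hx0 : x ∈ Set.Ici (0 : ℝ) := le_trans (show (0 : ℝ) ≤ a from ha) hx.1
    simp only [Set.mem_ofPred_eq, eval_C]
    exact le_antisymm ((hmono hx0 hb hx.2).trans heq.ge) (hmono ha hx0 hx.1)
  have hd := congrArg (fun p => (derivative p).eval 1) hconst
  simp only [derivative_sonin hn, derivative_C, eval_zero, derivative_gegenbauerQ hn, eval_mul,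
    eval_C, eval_X, eval_pow] at hd
  have h1 := gegenbauerQ_eval_one_pos (n := n + 2) (by lia) k
  have h2 : (0 : ℝ) < 2 * (n - 2) := by linarith
  have h4 : (0 : ℝ) < n := by linarith
  exact absurd hd (by positivity)

/-- A minimizer of `Q_{n,t}` on `[-1,1]` other than the end points is a critical point. -/
lemma eval_derivative_eq_zero_of_min {n t : ℕ} {x : ℝ} (hx : x ∈ Set.Ioo (-1 : ℝ) 1)
    (h : (gegenbauerQ n t).eval x = - minConst n t) :
    (derivative (gegenbauerQ n t)).eval x = 0 := by
  rw [← Polynomial.deriv]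
  refine IsLocalMin.deriv_eq_zero ?_
  filter_upwards [Icc_mem_nhds hx.1 hx.2] with y hy
  rw [h]
  exact neg_minConst_le hy

/-- For even `t ≥ 4`, the minimum of `Q_{n,t}` on `[-1,1]` is attained exactly at two points. -/
theorem exists_unique_minimizer {n : ℕ} (hn : 3 ≤ n) {e : ℕ} (he : 2 ≤ e) :
    ∃ α : ℝ, 0 < α ∧ α < 1 ∧ ∀ x ∈ Set.Icc (-1 : ℝ) 1,
      (gegenbauerQ n (2 * e)).eval x = - minConst n (2 * e) → x = α ∨ x = -α := by
  obtain ⟨k, hk⟩ : ∃ k, 2 * e = k + 1 + 1 + 1 + 1 := ⟨2 * e - 4, by lia⟩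
  have hc : 0 < minConst n (2 * e) := by rw [hk]; exact minConst_pos hn _
  have h1 : 0 < (gegenbauerQ n (2 * e)).eval 1 := gegenbauerQ_eval_one_pos hn _
  have hn3 : (3 : ℝ) ≤ n := by exact_mod_cast hn
  have hμ : (0 : ℝ) < ((2 * e : ℕ) : ℝ) * (n + (2 * e : ℕ) - 2) := by
    rw [hk]
    push_cast
    have : (0 : ℝ) ≤ k := k.cast_nonneg
    exact mul_pos (by linarith) (by linarith)
  have hson := sonin_strictMonoOn hn (k + 1 + 1 + 1)
  rw [← hk] at hson
  -- At critical points Sonin's function is `μQ²`, so its monotonicity compares critical values by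
  -- absolute value.
  have hval : ∀ x, (derivative (gegenbauerQ n (2 * e))).eval x = 0 →
      (sonin n (2 * e)).eval x =
        ((2 * e : ℕ) : ℝ) * (n + (2 * e : ℕ) - 2) * (gegenbauerQ n (2 * e)).eval x ^ 2 := by
    intro x hx
    simp [sonin, hx]
  have habs : ∀ x ∈ Set.Icc (-1 : ℝ) 1, (gegenbauerQ n (2 * e)).eval x = - minConst n (2 * e) →
      0 ≤ |x| ∧ |x| < 1 ∧ (gegenbauerQ n (2 * e)).eval |x| = - minConst n (2 * e) := by
    intro x hx h
    have hx' : (gegenbauerQ n (2 * e)).eval |x| = - minConst n (2 * e) := by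
      rcases abs_choice x with h' | h' <;> rw [h']
      · exact h
      · rw [gegenbauerQ_two_mul_eval_neg, h]
    refine ⟨abs_nonneg x, lt_of_le_of_ne (abs_le.mpr hx) fun h' => ?_, hx'⟩
    rw [h'] at hx'
    linarith
  obtain ⟨x₀, hx₀, hmin₀⟩ := (isLeast_neg_minConst n (2 * e)).1
  obtain ⟨ha0, ha1, hmin⟩ := habs x₀ hx₀ hmin₀
  set α := |x₀|
  have hcrit := eval_derivative_eq_zero_of_min ⟨by linarith, ha1⟩ hmin
  refine ⟨α, lt_of_le_of_ne ha0 fun hα => ?_, ha1, fun x hx h => ?_⟩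
  -- Let `z > 0` be the last critical point in `[0, 1]`. If the minimum were at `0`, then `Q(z)² >
  -- c²` with `Q(z) ≥ -c`, so `Q(z) > 0` and the differential equation gives `Q''(z) < 0`. But `Q' >
  -- 0` just to the right of `z`.
  · obtain ⟨z, -, hz0, hz1, hz, hzpos, -⟩ :=
      gegenbauerQ_last_zero (n := n + 2) (by lia) (k + 1 + 1)
    have hz0 := hz0 (by lia)
    have hder : ∀ x, (derivative (gegenbauerQ n (2 * e))).eval x =
        n * (gegenbauerQ (n + 2) (k + 1 + 1 + 1)).eval x := by
      intro x
      rw [hk, derivative_gegenbauerQ hn]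
      simp
    have hdz : (derivative (gegenbauerQ n (2 * e))).eval z = 0 := by rw [hder, hz, mul_zero]
    have hlt := hson (Set.mem_Ici.mpr ha0) (Set.mem_Ici.mpr hz0.le) (hα ▸ hz0)
    simp only [hval α hcrit, hval z hdz, hmin] at hlt
    have hsq := lt_of_mul_lt_mul_left hlt hμ.le
    have hge := neg_minConst_le (n := n) (t := 2 * e) (x := z) ⟨by linarith, hz1.le⟩
    have hQz : 0 < (gegenbauerQ n (2 * e)).eval z := by nlinarith
    have hode := gegenbauerQ_ode hn (2 * e) z
    rw [hdz] at hode
    have hdd : (derivative (derivative (gegenbauerQ n (2 * e)))).eval z < 0 := by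
      have h3 : 0 < 1 - z ^ 2 := by nlinarith
      have h4 := mul_pos hμ hQz
      by_contra! hcon
      have h5 := mul_nonneg h3.le hcon
      linarith
    have hd : HasDerivAt (fun x => (derivative (gegenbauerQ n (2 * e))).eval x)
        ((derivative (derivative (gegenbauerQ n (2 * e)))).eval z) z :=
      Polynomial.hasDerivAt _ _
    have hslope := (hasDerivAt_iff_tendsto_slope.mp hd).eventually_lt_const hdd
    have hev : ∀ᶠ x in nhdsWithin z (Set.Ioi z),
        slope (fun x => (derivative (gegenbauerQ n (2 * e))).eval x) z x < 0 :=
      hslope.filter_mono (nhdsWithin_mono _ fun x hx => ne_of_gt hx)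
    obtain ⟨x, hx, hx'⟩ := (hev.and (Ioo_mem_nhdsGT hz1)).exists
    rw [slope_def_field, hdz, sub_zero, hder] at hx
    have h6 := hzpos x hx'.1 hx'.2.le
    have h7 : 0 < x - z := sub_pos.mpr hx'.1
    have : 0 < n * (gegenbauerQ (n + 2) (k + 1 + 1 + 1)).eval x / (x - z) := by positivity
    linarith
  · obtain ⟨hb0, hb1, hminb⟩ := habs x hx h
    have hcritb := eval_derivative_eq_zero_of_min ⟨by linarith, hb1⟩ hminb
    have heq : |x| = α := by
      refine hson.injOn (Set.mem_Ici.mpr hb0) (Set.mem_Ici.mpr ha0) ?_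
      simp only [hval α hcrit, hval |x| hcritb, hmin, hminb]
    exact eq_or_eq_neg_of_abs_eq heq

end HarmonicDesign

/-! ### Zonal harmonic polynomials. -/

namespace HarmonicDesign

open MvPolynomial

open scoped RealInnerProductSpace

variable {n : ℕ}

/-- The linear form `∑ yᵢ Xᵢ`. -/
noncomputable def linForm (y : Fin n → ℝ) : MvPolynomial (Fin n) ℝ := ∑ i, C (y i) * X i

/-- The quadratic form `∑ Xᵢ²`. -/
noncomputable def normSqForm (n : ℕ) : MvPolynomial (Fin n) ℝ := ∑ i, X i ^ 2

/-- The derivative in direction `y`. -/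
noncomputable def dirDeriv (y : Fin n → ℝ) :
    Derivation ℝ (MvPolynomial (Fin n) ℝ) (MvPolynomial (Fin n) ℝ) :=
  ∑ i, y i • pderiv i

lemma dirDeriv_apply (y : Fin n → ℝ) (f : MvPolynomial (Fin n) ℝ) :
    dirDeriv y f = ∑ i, C (y i) * pderiv i f := by
  have h : ∀ s : Finset (Fin n), (∑ i ∈ s, y i • pderiv i :
      Derivation ℝ (MvPolynomial (Fin n) ℝ) (MvPolynomial (Fin n) ℝ)) f =
        ∑ i ∈ s, C (y i) * pderiv i f := by
    classical
    intro s
    induction s using Finset.induction_on with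
    | empty => simp
    | insert i s hi ih =>
      rw [Finset.sum_insert hi, Finset.sum_insert hi, Derivation.add_apply, ih,
        Derivation.smul_apply, smul_eq_C_mul]
  exact h Finset.univ

lemma pderiv_linForm (y : Fin n → ℝ) (i : Fin n) : pderiv i (linForm y) = C (y i) := by
  simp [linForm, pderiv_X, Pi.single_apply]

lemma pderiv_normSqForm (i : Fin n) : pderiv i (normSqForm n) = 2 * X i := by
  simp [normSqForm, pderiv_X, Pi.single_apply, Derivation.leibniz_pow]

lemma dirDeriv_linForm (y : Fin n → ℝ) : dirDeriv y (linForm y) = C (∑ i, y i ^ 2) := by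
  simp [dirDeriv_apply, pderiv_linForm, pow_two]

lemma dirDeriv_normSqForm (y : Fin n → ℝ) : dirDeriv y (normSqForm n) = 2 * linForm y := by
  simp only [dirDeriv_apply, pderiv_normSqForm, linForm, Finset.mul_sum]
  exact Finset.sum_congr rfl fun i _ => by ring

lemma laplacian_mul (f g : MvPolynomial (Fin n) ℝ) :
    laplacian (f * g) =
      laplacian f * g + f * laplacian g + 2 * ∑ i, pderiv i f * pderiv i g := by
  simp only [laplacian, Finset.mul_sum, Finset.sum_mul, ← Finset.sum_add_distrib]
  refine Finset.sum_congr rfl fun i _ => ?_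
  simp only [pderiv_mul, map_add]
  ring

lemma laplacian_sub (f g : MvPolynomial (Fin n) ℝ) :
    laplacian (f - g) = laplacian f - laplacian g := by
  simp [laplacian, Finset.sum_sub_distrib]

lemma laplacian_C_mul (a : ℝ) (f : MvPolynomial (Fin n) ℝ) :
    laplacian (C a * f) = C a * laplacian f := by
  simp [laplacian, Finset.mul_sum]

lemma laplacian_linForm_mul (y : Fin n → ℝ) (f : MvPolynomial (Fin n) ℝ) :
    laplacian (linForm y * f) = linForm y * laplacian f + 2 * dirDeriv y f := by
  have : laplacian (linForm y) = 0 := by simp [laplacian, pderiv_linForm]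
  rw [laplacian_mul, this, dirDeriv_apply]
  simp [pderiv_linForm]

lemma laplacian_normSqForm_mul {k : ℕ} {f : MvPolynomial (Fin n) ℝ} (hf : f.IsHomogeneous k) :
    laplacian (normSqForm n * f) = normSqForm n * laplacian f + C (2 * (n + 2 * k) : ℝ) * f := by
  have h : laplacian (normSqForm n) = C (2 * n : ℝ) := by
    simp [laplacian, pderiv_normSqForm, pderiv_X, mul_comm,
      ← map_ofNat (C : ℝ →+* MvPolynomial (Fin n) ℝ)]
  have h2 : ∑ i, pderiv i (normSqForm n) * pderiv i f = 2 * (C (k : ℝ) * f) := by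
    have := hf.sum_X_mul_pderiv
    simp only [pderiv_normSqForm, mul_assoc, ← Finset.mul_sum, this]
    simp
  rw [laplacian_mul, h, h2]
  simp only [map_add, map_mul, map_ofNat]
  ring

/-- The zonal polynomials: the homogeneous polynomials `|y|ᵏ|x|ᵏ Q_{n,k}(x·y/(|x||y|))`
for a unit vector `y`. -/
noncomputable def zonal (y : Fin n → ℝ) : ℕ → MvPolynomial (Fin n) ℝ
  | 0 => 1
  | 1 => C (n : ℝ) * linForm y
  | k + 2 => C (gegenbauerCoeff n (k + 2))⁻¹ *
      (linForm y * zonal y (k + 1) -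
        C (1 - gegenbauerCoeff n k) * (normSqForm n * zonal y k))

lemma isHomogeneous_linForm (y : Fin n → ℝ) : (linForm y).IsHomogeneous 1 :=
  IsHomogeneous.sum _ _ _ fun i _ => by
    simpa using (isHomogeneous_C (Fin n) (y i)).mul (isHomogeneous_X ℝ i)

lemma isHomogeneous_normSqForm : (normSqForm n).IsHomogeneous 2 :=
  IsHomogeneous.sum _ _ _ fun i _ => by simpa using (isHomogeneous_X ℝ i).pow 2

lemma isHomogeneous_zonal (y : Fin n → ℝ) : ∀ k, (zonal y k).IsHomogeneous k
  | 0 => isHomogeneous_one _ _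
  | 1 => by simpa [zonal] using (isHomogeneous_C (Fin n) (n : ℝ)).mul (isHomogeneous_linForm y)
  | k + 2 => by
    have h1 := (isHomogeneous_linForm y).mul (isHomogeneous_zonal y (k + 1))
    have h0 := (isHomogeneous_C (Fin n) (1 - gegenbauerCoeff n k)).mul
      (isHomogeneous_normSqForm.mul (isHomogeneous_zonal y k))
    rw [show 1 + (k + 1) = k + 2 by ring] at h1
    rw [show 0 + (2 + k) = k + 2 by ring] at h0
    have h := (isHomogeneous_C (Fin n) (gegenbauerCoeff n (k + 2))⁻¹).mul (h1.sub h0)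
    rw [zero_add] at h
    exact h

/-- On the sphere `normSqForm` equals `1`, and the recursion becomes that of `gegenbauerQ`. -/
lemma eval_zonal (y : Fin n → ℝ) {x : Fin n → ℝ} (hx : ∑ i, x i ^ 2 = 1) (k : ℕ) :
    eval x (zonal y k) = (gegenbauerQ n k).eval (∑ i, y i * x i) := by
  have hl : eval x (linForm y) = ∑ i, y i * x i := by simp [linForm]
  have hr : eval x (normSqForm n) = 1 := by simp [normSqForm, hx]
  induction k using Nat.twoStepInduction with
  | zero => simp [zonal, gegenbauerQ]
  | one => simp [zonal, gegenbauerQ, hl]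
  | more k h0 h1 => simp [zonal, gegenbauerQ, hl, hr, h0, h1]

lemma C_mul_zonal_add_two (hn : 3 ≤ n) (y : Fin n → ℝ) (k : ℕ) :
    C (gegenbauerCoeff n (k + 2)) * zonal y (k + 2) = linForm y * zonal y (k + 1) -
      C (1 - gegenbauerCoeff n k) * (normSqForm n * zonal y k) := by
  rw [zonal, ← mul_assoc, ← C_mul, mul_inv_cancel₀ (gegenbauerCoeff_succ_pos hn (k + 1)).ne',
    C_1, one_mul]

lemma dirDeriv_C_mul (y : Fin n → ℝ) (a : ℝ) (f : MvPolynomial (Fin n) ℝ) :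
    dirDeriv y (C a * f) = C a * dirDeriv y f := by
  rw [← smul_eq_C_mul, Derivation.map_smul, smul_eq_C_mul]

lemma C_gegenbauerCoeff_succ_ne_zero (hn : 3 ≤ n) (k : ℕ) :
    (C (gegenbauerCoeff n (k + 1)) : MvPolynomial (Fin n) ℝ) ≠ 0 :=
  C_ne_zero.mpr (gegenbauerCoeff_succ_pos hn k).ne'

lemma dirDeriv_C_mul_zonal_add_two (hn : 3 ≤ n) {y : Fin n → ℝ} (hy : ∑ i, y i ^ 2 = 1) (k : ℕ) :
    C (gegenbauerCoeff n (k + 2)) * dirDeriv y (zonal y (k + 2)) =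
      zonal y (k + 1) + linForm y * dirDeriv y (zonal y (k + 1)) -
        C (1 - gegenbauerCoeff n k) *
          (2 * linForm y * zonal y k + normSqForm n * dirDeriv y (zonal y k)) := by
  have h := congrArg (dirDeriv y) (C_mul_zonal_add_two hn y k)
  rw [dirDeriv_C_mul, map_sub, dirDeriv_C_mul] at h
  simp only [Derivation.leibniz, smul_eq_mul, dirDeriv_linForm, dirDeriv_normSqForm, hy, C_1] at h
  linear_combination h

/-- The derivative of a zonal polynomial along its axis. -/
theorem dirDeriv_zonal (hn : 3 ≤ n) {y : Fin n → ℝ} (hy : ∑ i, y i ^ 2 = 1) : ∀ k : ℕ,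
    dirDeriv y (zonal y (k + 1)) = C (loweringCoeff n k) * zonal y k
  | 0 => by
    simp [zonal, dirDeriv_linForm, hy, loweringCoeff, gegenbauerCoeff_zero]
  | 1 => by
    have h := dirDeriv_C_mul_zonal_add_two hn hy 0
    have e := congrArg (C : ℝ → MvPolynomial (Fin n) ℝ) (gegenbauerCoeff_mul_loweringCoeff hn 0)
    have e1 := congrArg (C : ℝ → MvPolynomial (Fin n) ℝ) (gegenbauerCoeff_mul hn 1)
    apply mul_left_cancel₀ (C_gegenbauerCoeff_succ_ne_zero hn 1)
    have a0 : zonal y 0 = 1 := rfl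
    have a1 : zonal y 1 = C (n : ℝ) * linForm y := rfl
    simp only [zero_add, one_add_one_eq_two] at *
    rw [h, a0, a1, dirDeriv_C_mul, dirDeriv_linForm, hy, gegenbauerCoeff_zero]
    simp only [map_add, map_sub, map_mul, map_natCast, map_ofNat, map_zero,
      Derivation.map_one_eq_zero, C_1, Nat.cast_zero, Nat.cast_one] at *
    linear_combination - (n : MvPolynomial (Fin n) ℝ) * linForm y * e
      - (n : MvPolynomial (Fin n) ℝ) * linForm y * e1 + 2 * linForm y * e1
  | k + 2 => by
    have ih0 := dirDeriv_zonal hn hy k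
    have ih1 := dirDeriv_zonal hn hy (k + 1)
    have h := dirDeriv_C_mul_zonal_add_two hn hy (k + 1)
    have h2 := C_mul_zonal_add_two hn y k
    have e1 := congrArg (C : ℝ → MvPolynomial (Fin n) ℝ) (loweringCoeff_sub hn (k + 1))
    have e2 := congrArg (C : ℝ → MvPolynomial (Fin n) ℝ) (mul_loweringCoeff hn k)
    have e3 := congrArg (C : ℝ → MvPolynomial (Fin n) ℝ)
      (gegenbauerCoeff_mul_loweringCoeff hn (k + 1))
    apply mul_left_cancel₀ (C_gegenbauerCoeff_succ_ne_zero hn (k + 2))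
    simp only [add_assoc, Nat.reduceAdd] at *
    rw [h, ih0, ih1]
    simp only [map_add, map_sub, map_mul, map_natCast, map_ofNat, C_1, Nat.cast_add, Nat.cast_one]
      at *
    linear_combination linForm y * zonal y (k + 1) * e1 - normSqForm n * zonal y k * e2
      - zonal y (k + 2) * e3 - ((n : MvPolynomial (Fin n) ℝ) + k - 1) * h2

/-- The linear form contributes `2 ∂_y Z_{k+1} = 2 c_k Z_k`, with `c_k` the lowering factor, and the
quadratic form contributes `2(n + 2k)(1 - λ_k) Z_k`; these agree and cancel. -/
theorem laplacian_zonal (hn : 3 ≤ n) {y : Fin n → ℝ} (hy : ∑ i, y i ^ 2 = 1) : ∀ k : ℕ,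
    laplacian (zonal y k) = 0
  | 0 => by simp [zonal, laplacian]
  | 1 => by simp [zonal, laplacian, pderiv_linForm]
  | k + 2 => by
    have e : loweringCoeff n k = (1 - gegenbauerCoeff n k) * (n + 2 * k) := rfl
    rw [zonal, laplacian_C_mul, laplacian_sub, laplacian_C_mul, laplacian_linForm_mul,
      laplacian_normSqForm_mul (isHomogeneous_zonal y k), laplacian_zonal hn hy k,
      laplacian_zonal hn hy (k + 1), dirDeriv_zonal hn hy k, e]
    simp only [map_mul, map_ofNat]
    ring

lemma isHarm_zonal (hn : 3 ≤ n) {y : Fin n → ℝ} (hy : ∑ i, y i ^ 2 = 1) (k : ℕ) :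
    IsHarm k (zonal y k) :=
  ⟨isHomogeneous_zonal y k, laplacian_zonal hn hy k⟩

/-! ### Equality in the Fisher type bound and equiangular sets. -/

lemma sum_sq_eq_one {x : EuclideanSpace ℝ (Fin n)} (hx : ‖x‖ = 1) : ∑ i, x i ^ 2 = 1 := by
  rw [← EuclideanSpace.real_norm_sq_eq, hx, one_pow]

lemma inner_eq_sum (x y : EuclideanSpace ℝ (Fin n)) : ⟪x, y⟫ = ∑ i, x i * y i := by
  simp [PiLp.inner_apply, mul_comm]

theorem IsDesignOfHarmonicIndex.sum_gegenbauerQ (hn : 3 ≤ n) {t : ℕ}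
    {Y : Finset (EuclideanSpace ℝ (Fin n))} (hY : IsDesignOfHarmonicIndex t Y)
    {x : EuclideanSpace ℝ (Fin n)} (hx : x ∈ Y) :
    ∑ y ∈ Y, (gegenbauerQ n t).eval ⟪x, y⟫ = 0 := by
  rw [← hY.sum_eq_zero _ (isHarm_zonal hn (sum_sq_eq_one (hY.norm_eq_one x hx)) t)]
  refine Finset.sum_congr rfl fun y hy => ?_
  rw [eval_zonal _ (sum_sq_eq_one (hY.norm_eq_one y hy)), inner_eq_sum]

lemma inner_mem_Icc {x y : EuclideanSpace ℝ (Fin n)} (hx : ‖x‖ = 1) (hy : ‖y‖ = 1) :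
    ⟪x, y⟫ ∈ Set.Icc (-1 : ℝ) 1 := by
  have := abs_real_inner_le_norm x y
  rw [hx, hy, one_mul] at this
  exact abs_le.mp this

/-- In a tight design all inner products of distinct points are minimizers of `Q_{n,t}`. -/
theorem IsTightDesign.eval_inner (hn : 3 ≤ n) {k : ℕ} {Y : Finset (EuclideanSpace ℝ (Fin n))}
    (hY : IsTightDesign (k + 2) Y) {x y : EuclideanSpace ℝ (Fin n)} (hx : x ∈ Y) (hy : y ∈ Y)
    (hxy : x ≠ y) : (gegenbauerQ n (k + 2)).eval ⟪x, y⟫ = - minConst n (k + 2) := by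
  classical
  have hD := hY.isDesign
  have hsum := hD.sum_gegenbauerQ hn hx
  have hc := minConst_pos hn k
  have hcard := hY.card_eq
  rw [← Finset.add_sum_erase Y _ hx, real_inner_self_eq_norm_sq, hD.norm_eq_one x hx, one_pow]
    at hsum
  rw [fisherBound, ← Finset.card_erase_add_one hx] at hcard
  push_cast at hcard
  have hcard' : ((Y.erase x).card : ℝ) * minConst n (k + 2) = (gegenbauerQ n (k + 2)).eval 1 := by
    rw [← eq_div_iff hc.ne']
    linarith
  have hnn : ∀ z ∈ Y.erase x, 0 ≤ (gegenbauerQ n (k + 2)).eval ⟪x, z⟫ + minConst n (k + 2) := by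
    intro z hz
    have := neg_minConst_le (n := n) (t := k + 2)
      (inner_mem_Icc (hD.norm_eq_one x hx) (hD.norm_eq_one z (Finset.mem_of_mem_erase hz)))
    linarith
  -- Tightness says `(|Y| - 1) c = Q(1)`, which makes this sum of non-negative terms vanish.
  have hzero : ∑ z ∈ Y.erase x,
      ((gegenbauerQ n (k + 2)).eval ⟪x, z⟫ + minConst n (k + 2)) = 0 := by
    rw [Finset.sum_add_distrib, Finset.sum_const, nsmul_eq_mul, hcard']
    linarith
  have := (Finset.sum_eq_zero_iff_of_nonneg hnn).mp hzero y
    (Finset.mem_erase.mpr ⟨hxy.symm, hy⟩)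
  linarith

/-- The coordinates of `x xᵀ`, indexed by unordered pairs. -/
def veronese (x : EuclideanSpace ℝ (Fin n)) : Sym2 (Fin n) → ℝ :=
  Sym2.lift ⟨fun i j => x i * x j, fun i j => mul_comm (x i) (x j)⟩

/-- The bound of Gerzon for equiangular sets of unit vectors. -/
theorem card_le_of_inner_sq_eq {Y : Finset (EuclideanSpace ℝ (Fin n))} {α : ℝ}
    (h1 : ∀ x ∈ Y, ‖x‖ = 1) (hα : α ^ 2 < 1)
    (hin : ∀ x ∈ Y, ∀ y ∈ Y, x ≠ y → ⟪x, y⟫ ^ 2 = α ^ 2) :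
    (Y.card : ℝ) ≤ n * (n + 1) / 2 := by
  classical
  -- Pairing a relation `∑ a_x xxᵀ = 0` with `yyᵀ` gives `∑ a_x (x·y)² = 0`; the Gram matrix `(1 -
  -- α²)I + α²J` is nonsingular. The space of symmetric matrices has dimension `n(n+1)/2`.
  have hli : LinearIndependent ℝ (fun x : Y => veronese (x : EuclideanSpace ℝ (Fin n))) := by
    rw [Fintype.linearIndependent_iff]
    intro a ha
    have hij : ∀ i j, ∑ x : Y, a x * ((x : EuclideanSpace ℝ (Fin n)) i * x.1 j) = 0 := by
      intro i j
      have := congrFun ha s(i, j)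
      simpa [veronese, Finset.sum_apply] using this
    have hy : ∀ y : Y, ∑ x : Y, a x * ⟪(x : EuclideanSpace ℝ (Fin n)), y⟫ ^ 2 = 0 := by
      intro y
      have h : ∀ x : Y, a x * ⟪(x : EuclideanSpace ℝ (Fin n)), y⟫ ^ 2 =
          ∑ i, ∑ j, y.1 i * y.1 j * (a x * (x.1 i * x.1 j)) := by
        intro x
        rw [inner_eq_sum, pow_two, Finset.sum_mul_sum, Finset.mul_sum]
        refine Finset.sum_congr rfl fun i _ => ?_
        rw [Finset.mul_sum]
        exact Finset.sum_congr rfl fun j _ => by ring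
      simp only [h]
      rw [Finset.sum_comm]
      refine Finset.sum_eq_zero fun i _ => ?_
      rw [Finset.sum_comm]
      refine Finset.sum_eq_zero fun j _ => ?_
      rw [← Finset.mul_sum, hij, mul_zero]
    have hy' : ∀ y : Y, (1 - α ^ 2) * a y + α ^ 2 * ∑ x, a x = 0 := by
      intro y
      rw [← hy y, ← Finset.add_sum_erase _ _ (Finset.mem_univ y),
        ← Finset.add_sum_erase _ (fun x : Y => a x * ⟪(x : EuclideanSpace ℝ (Fin n)), y⟫ ^ 2)
          (Finset.mem_univ y), real_inner_self_eq_norm_sq, h1 y y.2, mul_add, Finset.mul_sum]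
      have : ∀ x ∈ Finset.univ.erase y,
          a x * ⟪(x : EuclideanSpace ℝ (Fin n)), y⟫ ^ 2 = α ^ 2 * a x := by
        intro x hx
        rw [hin x x.2 y y.2 fun h => (Finset.mem_erase.mp hx).1 (Subtype.ext h), mul_comm]
      rw [Finset.sum_congr rfl this]
      ring
    -- Summing `hy'` over `y` multiplies the total by `1 - α² + |Y|α² > 0`.
    have hS : ∑ x, a x = 0 := by
      have h := Finset.sum_eq_zero (s := Finset.univ) fun y _ => hy' y
      rw [Finset.sum_add_distrib, ← Finset.mul_sum, Finset.sum_const, nsmul_eq_mul] at h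
      have h2 : (1 - α ^ 2 + (Finset.univ : Finset Y).card * α ^ 2) * ∑ x, a x = 0 := by
        linear_combination h
      refine (mul_eq_zero.mp h2).resolve_left (ne_of_gt ?_)
      have : 0 ≤ ((Finset.univ : Finset Y).card : ℝ) * α ^ 2 := by positivity
      linarith
    intro y
    have h := hy' y
    rw [hS, mul_zero, add_zero] at h
    exact (mul_eq_zero.mp h).resolve_left (by linarith)
  have h := hli.fintype_card_le_finrank
  rw [Module.finrank_fintype_fun_eq_card, Sym2.card, Fintype.card_coe, Fintype.card_fin] at h
  have h2 : (Y.card : ℝ) ≤ ((n + 1).choose 2 : ℕ) := by exact_mod_cast h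
  rw [Nat.cast_choose_two] at h2
  push_cast at h2
  linarith

theorem IsTightDesign.equiangular (hn : 3 ≤ n) {e : ℕ} (he : 2 ≤ e)
    {Y : Finset (EuclideanSpace ℝ (Fin n))} (hY : IsTightDesign (2 * e) Y) :
    (∃ α : ℝ, 0 < α ∧ innerProducts Y ⊆ {α, -α}) ∧ (Y.card : ℝ) ≤ (n : ℝ) * ((n : ℝ) + 1) / 2 := by
  obtain ⟨α, h0, h1, hα⟩ := exists_unique_minimizer hn he
  have key : ∀ x ∈ Y, ∀ y ∈ Y, x ≠ y → ⟪x, y⟫ = α ∨ ⟪x, y⟫ = -α := by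
    intro x hx y hy hxy
    refine hα _ (inner_mem_Icc (hY.isDesign.norm_eq_one x hx) (hY.isDesign.norm_eq_one y hy)) ?_
    obtain ⟨k, hk⟩ : ∃ k, 2 * e = k + 2 := ⟨2 * e - 2, by lia⟩
    rw [hk] at hY ⊢
    exact hY.eval_inner hn hx hy hxy
  refine ⟨⟨α, h0, ?_⟩, card_le_of_inner_sq_eq hY.isDesign.norm_eq_one (α := α) (by nlinarith) ?_⟩
  · rintro r ⟨x, hx, y, hy, hxy, rfl⟩
    exact key x hx y hy hxy
  · intro x hx y hy hxy
    rcases key x hx y hy hxy with h | h <;> rw [h]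
    exact neg_sq α

end HarmonicDesign

/-! ### Polynomials given by recurrences and convergence of their minima. -/

namespace HarmonicDesign

open Polynomial Filter Topology

/-- The polynomials with `p₀ = 1`, `p₁ = X` and `aₖ p_{k+2} = X p_{k+1} - bₖ pₖ`. -/
noncomputable def recPoly (a b : ℕ → ℝ) : ℕ → ℝ[X]
  | 0 => 1
  | 1 => X
  | k + 2 => C (a k)⁻¹ * (X * recPoly a b (k + 1) - C (b k) * recPoly a b k)

lemma natDegree_recPoly_le (a b : ℕ → ℝ) : ∀ k, (recPoly a b k).natDegree ≤ k
  | 0 => by simp [recPoly]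
  | 1 => by simp [recPoly]
  | k + 2 => by
    rw [recPoly]
    refine natDegree_C_mul_le _ _ |>.trans <| (natDegree_sub_le _ _).trans (max_le ?_ ?_)
    · refine natDegree_mul_le.trans ?_
      have := natDegree_recPoly_le a b (k + 1)
      rw [natDegree_X]
      lia
    · refine (natDegree_C_mul_le _ _).trans ?_
      have := natDegree_recPoly_le a b k
      lia

lemma coeff_recPoly_pos {a b : ℕ → ℝ} (ha : ∀ k, 0 < a k) : ∀ k, 0 < (recPoly a b k).coeff k
  | 0 => by simp [recPoly]
  | 1 => by simp [recPoly]
  | k + 2 => by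
    have h : (recPoly a b k).coeff (k + 2) = 0 :=
      coeff_eq_zero_of_natDegree_lt ((natDegree_recPoly_le a b k).trans_lt (by lia))
    rw [recPoly, coeff_C_mul, coeff_sub, coeff_X_mul, coeff_C_mul, h, mul_zero, sub_zero]
    exact mul_pos (inv_pos.mpr (ha k)) (coeff_recPoly_pos ha (k + 1))

lemma eval_neg_recPoly (a b : ℕ → ℝ) (k : ℕ) (x : ℝ) :
    (recPoly a b k).eval (-x) = (-1) ^ k * (recPoly a b k).eval x := by
  induction k using Nat.twoStepInduction with
  | zero => simp [recPoly]
  | one => simp [recPoly]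
  | more k h0 h1 =>
    simp only [recPoly, eval_mul, eval_C, eval_sub, eval_X, h0, h1]
    ring

lemma tendsto_coeff_recPoly {a b : ℕ → ℕ → ℝ} {a' b' : ℕ → ℝ} (ha' : ∀ k, a' k ≠ 0)
    (ha : ∀ k, Tendsto (fun n => a n k) atTop (𝓝 (a' k)))
    (hb : ∀ k, Tendsto (fun n => b n k) atTop (𝓝 (b' k))) : ∀ k j,
    Tendsto (fun n => (recPoly (a n) (b n) k).coeff j) atTop (𝓝 ((recPoly a' b' k).coeff j))
  | 0, j => by simp [recPoly]
  | 1, j => by simp [recPoly]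
  | k + 2, j => by
    simp only [recPoly, coeff_C_mul, coeff_sub]
    refine ((ha k).inv₀ (ha' k)).mul (Tendsto.sub ?_ ?_)
    · cases j with
      | zero => simp
      | succ j =>
        simp only [coeff_X_mul]
        exact tendsto_coeff_recPoly ha' ha hb (k + 1) j
    · exact (hb k).mul (tendsto_coeff_recPoly ha' ha hb k j)

lemma eventually_pos_recPoly {a b : ℕ → ℝ} (ha : ∀ k, 0 < a k) (k : ℕ) :
    ∀ᶠ x in atTop, 0 < (recPoly a b k).eval x := by
  cases k with
  | zero => simp [recPoly]
  | succ k =>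
    have hc := coeff_recPoly_pos (b := b) ha (k + 1)
    have hd : (recPoly a b (k + 1)).natDegree = k + 1 :=
      natDegree_eq_of_le_of_coeff_ne_zero (natDegree_recPoly_le a b _) hc.ne'
    refine (Polynomial.tendsto_atTop_of_leadingCoeff_nonneg _ ?_ ?_).eventually_gt_atTop 0
    · exact natDegree_pos_iff_degree_pos.mp (by lia)
    · rw [leadingCoeff, hd]
      exact hc.le

/-- The interlacing argument applies on `[0, M]` with `M` so large that the polynomials of degree at
most `k + 1` are all positive at `M`. -/
lemma exists_eval_recPoly_neg {a b : ℕ → ℝ} (ha : ∀ k, 0 < a k) (hb : ∀ k, 0 < b k) (k : ℕ) :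
    ∃ x, (recPoly a b (k + 2)).eval x < 0 := by
  have h := (eventually_all_finite (Set.finite_Iic (k + 1))).mpr
    fun i _ => eventually_pos_recPoly (b := b) ha i
  obtain ⟨M, hM, hM0⟩ := (h.and (eventually_ge_atTop 0)).exists
  obtain ⟨z, -, -, -, -, -, hz⟩ := exists_last_zero_of_recurrence (K := k + 1)
    (p := fun k x => (recPoly a b k).eval x) hM0 (fun k => (recPoly a b k).continuous) ha hb
    (fun k x => by
      have := (ha k).ne'
      simp only [recPoly, eval_mul, eval_C, eval_sub, eval_X]
      field_simp)
    (by simp [recPoly]) (by simp [recPoly]) (by simp [recPoly]) (fun i hi => hM i hi) k le_rfl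
  exact ⟨z, hz⟩

/-- An even polynomial of degree `d > 0` with positive leading coefficient grows like `x ^ d`. -/
lemma exists_lower_bound {p : ℝ[X]} {d : ℕ} (hd : 0 < d) (hp : p.natDegree ≤ d)
    (hc : 0 < p.coeff d) (hev : ∀ x, p.eval (-x) = p.eval x) (hde : Even d) :
    ∃ a : ℝ, 0 < a ∧ ∃ K : ℝ, ∀ x, a * x ^ d - K ≤ p.eval x := by
  -- Half the leading coefficient leaves a remainder that still tends to `+∞`, hence is bounded
  -- below on `x ≥ 0`; evenness covers the rest.
  set a := p.coeff d / 2 with ha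
  have ha0 : 0 < a := by positivity
  set r := p - C a * X ^ d with hr
  have hrc : r.coeff d = a := by simp [hr, ha, sub_half]
  have hrd : r.natDegree = d := natDegree_eq_of_le_of_coeff_ne_zero
    ((natDegree_sub_le _ _).trans (max_le hp (natDegree_C_mul_X_pow_le _ _)))
    (by rw [hrc]; exact ha0.ne')
  have ht : Tendsto (fun x => r.eval x) atTop atTop := by
    refine Polynomial.tendsto_atTop_of_leadingCoeff_nonneg _ ?_ ?_
    · exact natDegree_pos_iff_degree_pos.mp (by lia)
    · rw [leadingCoeff, hrd, hrc]
      exact ha0.le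
  obtain ⟨T, hT⟩ := eventually_atTop.mp (ht.eventually_ge_atTop 0)
  obtain ⟨K, hK⟩ := (isCompact_Icc (a := (0 : ℝ)) (b := T)).bddBelow_image
    r.continuous.continuousOn
  have hpos : ∀ x, 0 ≤ x → min K 0 ≤ r.eval x := by
    intro x hx
    rcases le_total x T with h | h
    · exact (min_le_left _ _).trans (hK ⟨x, ⟨hx, h⟩, rfl⟩)
    · exact (min_le_right _ _).trans (hT x h)
  refine ⟨a, ha0, - min K 0, fun x => ?_⟩
  have hx := hpos |x| (abs_nonneg x)
  have hpx : p.eval |x| = p.eval x := by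
    rcases abs_choice x with h | h <;> rw [h]
    exact hev x
  simp only [hr, eval_sub, eval_mul, eval_C, eval_pow, eval_X, hpx, hde.pow_abs] at hx
  linarith

/-- Since `|x|^j ≤ 1 + x^d` for `j ≤ d`, coefficientwise closeness gives an error bound valid on the
whole line, which growing intervals require. -/
lemma abs_eval_sub_eval_le {p q : ℝ[X]} {d : ℕ} (hp : p.natDegree ≤ d) (hq : q.natDegree ≤ d)
    (hd : Even d) (x : ℝ) :
    |q.eval x - p.eval x| ≤
      (∑ j ∈ Finset.range (d + 1), |q.coeff j - p.coeff j|) * (1 + x ^ d) := by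
  rw [eval_eq_sum_range' (Nat.lt_succ_of_le hp), eval_eq_sum_range' (Nat.lt_succ_of_le hq),
    ← Finset.sum_sub_distrib, Finset.sum_mul]
  refine (Finset.abs_sum_le_sum_abs _ _).trans (Finset.sum_le_sum fun j hj => ?_)
  rw [← sub_mul, abs_mul, abs_pow]
  refine mul_le_mul_of_nonneg_left ?_ (abs_nonneg _)
  have hj' : j ≤ d := Nat.lt_succ_iff.mp (Finset.mem_range.mp hj)
  rcases le_total |x| 1 with h | h
  · have h1 := pow_le_one₀ (n := j) (abs_nonneg x) h
    have h2 := hd.pow_nonneg x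
    linarith
  · have h1 := pow_le_pow_right₀ h hj'
    rw [hd.pow_abs x] at h1
    linarith

/-- Convergence of the minima of a sequence of polynomials on growing intervals. -/
theorem tendsto_sInf_image {p : ℝ[X]} {q : ℕ → ℝ[X]} {d : ℕ} (hd : 0 < d) (hde : Even d)
    (hp : p.natDegree ≤ d) (hc : 0 < p.coeff d) (hev : ∀ x, p.eval (-x) = p.eval x)
    (hq : ∀ n, (q n).natDegree ≤ d)
    (hlim : ∀ j, Tendsto (fun n => (q n).coeff j) atTop (𝓝 (p.coeff j)))
    {s : ℕ → ℝ} (hs0 : ∀ n, 0 ≤ s n) (hs : Tendsto s atTop atTop) :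
    Tendsto (fun n => sInf ((fun x => (q n).eval x) '' Set.Icc (-s n) (s n))) atTop
      (𝓝 (sInf (Set.range fun x => p.eval x))) := by
  obtain ⟨a, ha, K, hK⟩ := exists_lower_bound hd hp hc hev hde
  set m := sInf (Set.range fun x => p.eval x) with hm
  have hbdd : BddBelow (Set.range fun x => p.eval x) := by
    refine ⟨-K, ?_⟩
    rintro _ ⟨x, rfl⟩
    have := mul_nonneg ha.le (hde.pow_nonneg x)
    have := hK x
    simp only
    linarith
  have hmle : ∀ x, m ≤ p.eval x := fun x => csInf_le hbdd ⟨x, rfl⟩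
  set δ : ℕ → ℝ := fun n => ∑ j ∈ Finset.range (d + 1), |(q n).coeff j - p.coeff j| with hδ
  have hδ0 : ∀ n, 0 ≤ δ n := fun n => Finset.sum_nonneg fun j _ => abs_nonneg _
  have hδlim : Tendsto δ atTop (𝓝 0) := by
    have : Tendsto δ atTop (𝓝 (∑ j ∈ Finset.range (d + 1), |p.coeff j - p.coeff j|)) :=
      tendsto_finsetSum _ fun j _ => ((hlim j).sub_const _).abs
    simpa using this
  -- The error `δ(1 + x^d)` is absorbed by the growth of `p`, as `x^d ≤ (p(x) + K)/a`; the condition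
  -- `δ ≤ a` keeps the remaining coefficient `1 - δ/a` of `p(x) - m` non-negative.
  have hlow : ∀ n, δ n ≤ a → ∀ x, m - δ n * (1 + (m + K) / a) ≤ (q n).eval x := by
    intro n hn x
    have h1 := (abs_le.mp (abs_eval_sub_eval_le hp (hq n) hde x)).1
    have h2 : x ^ d ≤ (p.eval x + K) / a := by
      rw [le_div_iff₀ ha]
      linarith [hK x]
    have h3 := mul_le_mul_of_nonneg_left h2 (hδ0 n)
    have h4 : 0 ≤ (1 - δ n / a) * (p.eval x - m) :=
      mul_nonneg (sub_nonneg.mpr ((div_le_one ha).mpr hn)) (sub_nonneg.mpr (hmle x))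
    have h5 : δ n * ((p.eval x + K) / a) =
        δ n * ((m + K) / a) + δ n / a * (p.eval x - m) := by
      field_simp
      ring
    change -(δ n * (1 + x ^ d)) ≤ _ at h1
    linarith
  refine tendsto_order.mpr ⟨fun l hl => ?_, fun u hu => ?_⟩
  · have h1 : Tendsto (fun n => m - δ n * (1 + (m + K) / a)) atTop (𝓝 m) := by
      simpa using tendsto_const_nhds.sub (hδlim.mul_const (1 + (m + K) / a))
    filter_upwards [h1.eventually_const_lt hl, hδlim.eventually_le_const ha] with n hn1 hn2
    refine hn1.trans_le (le_csInf ?_ ?_)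
    · exact Set.Nonempty.image _ ⟨0, by simp [hs0 n]⟩
    · rintro _ ⟨x, -, rfl⟩
      exact hlow n hn2 x
  -- A single point with `p(x) < u` suffices: it eventually lies in the interval, and `q n`
  -- converges there.
  · obtain ⟨_, ⟨x, rfl⟩, hx⟩ := exists_lt_of_csInf_lt (Set.range_nonempty _) hu
    have h1 : Tendsto (fun n => (q n).eval x) atTop (𝓝 (p.eval x)) := by
      have := tendsto_finsetSum (Finset.range (d + 1)) fun j _ =>
        (hlim j).mul_const (x ^ j)
      rw [eval_eq_sum_range' (Nat.lt_succ_of_le hp)]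
      simpa only [eval_eq_sum_range' (Nat.lt_succ_of_le (hq _))] using this
    filter_upwards [h1.eventually_lt_const hx, hs.eventually_ge_atTop |x|] with n hn1 hn2
    exact (csInf_le (isCompact_Icc.bddBelow_image (q n).continuous.continuousOn)
      (Set.mem_image_of_mem _ (abs_le.mp hn2))).trans_lt hn1

/-! ### Hermite limit, growth of the Fisher bound, and nonexistence. -/

lemma tendsto_gegenbauerCoeff (k : ℕ) :
    Tendsto (fun n => gegenbauerCoeff n k) atTop (𝓝 0) := by
  refine Tendsto.const_div_atTop ?_ _
  simp only [add_sub_assoc]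
  exact tendsto_atTop_add_const_right _ _ tendsto_natCast_atTop_atTop

lemma tendsto_mul_gegenbauerCoeff (k : ℕ) :
    Tendsto (fun n : ℕ => n * gegenbauerCoeff n k) atTop (𝓝 k) := by
  have h : Tendsto (fun n : ℕ => k - gegenbauerCoeff n k * (2 * k - 2)) atTop (𝓝 k) := by
    simpa using tendsto_const_nhds.sub ((tendsto_gegenbauerCoeff k).mul_const (2 * (k : ℝ) - 2))
  refine h.congr' ?_
  filter_upwards [eventually_ge_atTop 3] with n hn
  linear_combination - gegenbauerCoeff_mul hn k

/-- The rescaled Gegenbauer polynomials `n ^ (-k/2) Q_{n,k}(x / √n)`. -/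
noncomputable def scaledQ (n : ℕ) : ℕ → ℝ[X] :=
  recPoly (fun k => n * gegenbauerCoeff n (k + 2)) (fun k => 1 - gegenbauerCoeff n k)

/-- The (rescaled) Hermite polynomials. -/
noncomputable def hermiteQ : ℕ → ℝ[X] := recPoly (fun k => (k : ℝ) + 2) (fun _ => 1)

lemma eval_gegenbauerQ_eq_scaledQ {n : ℕ} (hn : 3 ≤ n) (k : ℕ) (x : ℝ) :
    (gegenbauerQ n k).eval x = √n ^ k * (scaledQ n k).eval (√n * x) := by
  have hs : √(n : ℝ) ^ 2 = n := Real.sq_sqrt (by positivity)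
  induction k using Nat.twoStepInduction with
  | zero => simp [gegenbauerQ, scaledQ, recPoly]
  | one =>
    simp [gegenbauerQ, scaledQ, recPoly]
    linear_combination - x * hs
  | more k h0 h1 =>
    have hl := gegenbauerCoeff_succ_pos hn (k + 1)
    have hn0 : (0 : ℝ) < n := by positivity
    apply mul_left_cancel₀ hl.ne'
    rw [eval_gegenbauerQ_add_two hn, h0, h1]
    simp only [scaledQ, recPoly, eval_mul, eval_C, eval_sub, eval_X]
    rw [pow_succ, pow_add _ k 2, hs]
    field_simp

lemma tendsto_coeff_scaledQ (k j : ℕ) :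
    Tendsto (fun n => (scaledQ n k).coeff j) atTop (𝓝 ((hermiteQ k).coeff j)) := by
  refine tendsto_coeff_recPoly (fun k => by positivity) (fun k => ?_) (fun k => ?_) k j
  · simpa using tendsto_mul_gegenbauerCoeff (k + 2)
  · simpa using tendsto_const_nhds.sub (tendsto_gegenbauerCoeff k)

open Pointwise in
lemma minConst_eq {n : ℕ} (hn : 3 ≤ n) (e : ℕ) :
    minConst n (2 * e) =
      n ^ e * -sInf ((fun x => (scaledQ n (2 * e)).eval x) '' Set.Icc (-√n) √n) := by
  have hn0 : (0 : ℝ) < n := by positivity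
  have hs0 : 0 < √(n : ℝ) := Real.sqrt_pos.mpr hn0
  have hs : √(n : ℝ) ^ (2 * e) = n ^ e := by rw [pow_mul, Real.sq_sqrt hn0.le]
  have himg : (fun x : ℝ => (gegenbauerQ n (2 * e)).eval x) '' Set.Icc (-1) 1 =
      ((n : ℝ) ^ e) • ((fun x => (scaledQ n (2 * e)).eval x) '' Set.Icc (-√n) √n) := by
    ext r
    simp only [Set.mem_smul_set, Set.mem_image, exists_exists_and_eq_and, smul_eq_mul,
      eval_gegenbauerQ_eq_scaledQ hn, hs]
    constructor
    · rintro ⟨x, hx, rfl⟩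
      exact ⟨√n * x, ⟨by nlinarith [hx.1], by nlinarith [hx.2]⟩, rfl⟩
    · rintro ⟨x, hx, rfl⟩
      refine ⟨x / √n, ⟨?_, ?_⟩, ?_⟩
      · rw [le_div_iff₀ hs0]
        linarith [hx.1]
      · rw [div_le_one hs0]
        exact hx.2
      · rw [mul_div_cancel₀ _ hs0.ne']
  rw [minConst, himg, Real.sInf_smul_of_nonneg (by positivity), smul_eq_mul, mul_neg]

/-- Lowering at `x = 1` gives the ratio `Q_{k+1}(1)/Q_k(1) = (1 - λ_k)(n + 2k)/(k + 1)`. -/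
lemma tendsto_gegenbauerQ_eval_one (k : ℕ) :
    Tendsto (fun n : ℕ => (gegenbauerQ n k).eval 1 / (n : ℝ) ^ k) atTop
      (𝓝 ((k.factorial : ℝ)⁻¹)) := by
  induction k with
  | zero => simp [gegenbauerQ]
  | succ k ih =>
    have h1 : Tendsto (fun n : ℕ => (1 - gegenbauerCoeff n k) * (1 + 2 * k / (n : ℝ))) atTop
        (𝓝 1) := by
      have h2 : Tendsto (fun n : ℕ => 2 * (k : ℝ) / (n : ℝ)) atTop (𝓝 0) :=
        tendsto_natCast_atTop_atTop.const_div_atTop _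
      simpa using ((tendsto_gegenbauerCoeff k).const_sub 1).mul (h2.const_add 1)
    have h3 := (h1.mul ih).const_mul ((k : ℝ) + 1)⁻¹
    rw [one_mul, ← mul_inv, ← Nat.cast_succ, ← Nat.cast_mul, ← Nat.factorial_succ] at h3
    refine h3.congr' ?_
    filter_upwards [eventually_ge_atTop 3] with n hn
    have hn0 : (0 : ℝ) < n := by positivity
    have h := gegenbauerQ_lowering hn 1 k
    rw [loweringCoeff] at h
    simp only [one_pow, sub_self, zero_mul, zero_add, mul_one] at h
    rw [eq_div_iff (by positivity), Nat.cast_succ, inv_mul_eq_div, div_mul_eq_mul_div,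
      div_eq_iff (by positivity), mul_comm _ ((k : ℝ) + 1), h, pow_succ]
    field_simp

/-- The limit is `1/((2e)! · (-m))`, where `m` is the infimum of `hermiteQ (2 * e)`; it is finite by
the growth bound and negative by `exists_eval_recPoly_neg`. -/
theorem tendsto_fisherBound_div {e : ℕ} (he : 0 < e) :
    ∃ B : ℝ, 0 < B ∧
      Tendsto (fun n : ℕ => fisherBound n (2 * e) / (n : ℝ) ^ e) atTop (𝓝 B) := by
  have ha : ∀ k : ℕ, (0 : ℝ) < k + 2 := fun k => by positivity
  have hI := tendsto_sInf_image (p := hermiteQ (2 * e)) (q := fun n => scaledQ n (2 * e))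
    (d := 2 * e) (by lia) (even_two_mul e) (natDegree_recPoly_le _ _ _) (coeff_recPoly_pos ha _)
    (fun x => by simp [hermiteQ, eval_neg_recPoly]) (fun n => natDegree_recPoly_le _ _ _)
    (tendsto_coeff_scaledQ (2 * e)) (s := fun n : ℕ => √n) (fun n => Real.sqrt_nonneg _)
    (Real.tendsto_sqrt_atTop.comp tendsto_natCast_atTop_atTop)
  set m := sInf (Set.range fun x => (hermiteQ (2 * e)).eval x) with hm
  have hm0 : m < 0 := by
    obtain ⟨k, hk⟩ : ∃ k, 2 * e = k + 2 := ⟨2 * e - 2, by lia⟩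
    obtain ⟨x, hx⟩ := exists_eval_recPoly_neg ha (b := fun _ => 1) (fun _ => one_pos) k
    obtain ⟨a, ha', K, hK⟩ := exists_lower_bound (p := hermiteQ (2 * e)) (d := 2 * e) (by lia)
      (natDegree_recPoly_le _ _ _) (coeff_recPoly_pos ha _)
      (fun x => by simp [hermiteQ, eval_neg_recPoly]) (even_two_mul e)
    rw [← hk] at hx
    refine lt_of_le_of_lt (csInf_le ⟨-K, ?_⟩ (Set.mem_range_self x)) hx
    rintro _ ⟨y, rfl⟩
    have := mul_nonneg ha'.le ((even_two_mul e).pow_nonneg y)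
    have := hK y
    simp only
    linarith
  refine ⟨((2 * e).factorial : ℝ)⁻¹ / -m, div_pos (by positivity) (by linarith), ?_⟩
  have h1 : Tendsto (fun n : ℕ => 1 / (n : ℝ) ^ e) atTop (𝓝 0) :=
    ((tendsto_pow_atTop he.ne').comp tendsto_natCast_atTop_atTop).const_div_atTop 1
  have h2 := h1.add ((tendsto_gegenbauerQ_eval_one (2 * e)).div hI.neg (by linarith))
  rw [zero_add] at h2
  refine h2.congr' ?_
  filter_upwards [eventually_ge_atTop 3] with n hn
  have hn0 : (0 : ℝ) < n := by positivity
  rw [fisherBound, minConst_eq hn, add_div, Pi.div_apply, div_div, div_div]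
  congr 2
  ring

/-- For large `n` there is no tight design of harmonic index `2e`, since its size would exceed the
bound on equiangular lines. -/
theorem eventually_not_isTightDesign {e : ℕ} (he : 3 ≤ e) :
    ∃ N : ℕ, ∀ n : ℕ, N ≤ n →
      ¬ ∃ Y : Finset (EuclideanSpace ℝ (Fin n)), IsTightDesign (2 * e) Y := by
  obtain ⟨B, hB, hlim⟩ := tendsto_fisherBound_div (e := e) (by lia)
  have h1 := hlim.eventually_const_lt (half_lt_self hB)
  -- Once `n > 2/B`, the Fisher bound exceeds `(B/2)n^e ≥ (B/2)n³ ≥ n² ≥ n(n+1)/2`.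
  have h2 := tendsto_natCast_atTop_atTop.eventually_gt_atTop (2 / B)
  obtain ⟨N, hN⟩ := eventually_atTop.mp (h1.and (h2.and (eventually_ge_atTop 3)))
  refine ⟨N, fun n hn => ?_⟩
  rintro ⟨Y, hY⟩
  obtain ⟨hb, hn2, hn3⟩ := hN n hn
  have hcard := (hY.equiangular hn3 (by lia)).2
  rw [hY.card_eq] at hcard
  have hn1 : (1 : ℝ) ≤ n := by exact_mod_cast (by lia : 1 ≤ n)
  rw [lt_div_iff₀ (by positivity)] at hb
  rw [div_lt_iff₀ hB] at hn2
  have hpow : (n : ℝ) ^ 3 ≤ n ^ e := pow_le_pow_right₀ hn1 he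
  have h5 : B / 2 * (n : ℝ) ^ 3 ≤ B / 2 * n ^ e := mul_le_mul_of_nonneg_left hpow (by positivity)
  have h6 : (n : ℝ) ^ 2 * 2 ≤ n ^ 2 * (n * B) :=
    mul_le_mul_of_nonneg_left hn2.le (by positivity)
  nlinarith

end HarmonicDesign

theorem mainTheorem4 (e : ℕ) (he : 3 ≤ e) :
    (∃ N : ℕ, ∀ n : ℕ, N ≤ n →
      ¬ ∃ Y : Finset (EuclideanSpace ℝ (Fin n)), HarmonicDesign.IsTightDesign (2 * e) Y) ∧
    (∀ n : ℕ, 3 ≤ n → ∀ Y : Finset (EuclideanSpace ℝ (Fin n)),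
      HarmonicDesign.IsTightDesign (2 * e) Y →
        (∃ α : ℝ, 0 < α ∧ HarmonicDesign.innerProducts Y ⊆ {α, -α}) ∧
        (Y.card : ℝ) ≤ (n : ℝ) * ((n : ℝ) + 1) / 2) ∧
    (∃ B : ℝ, 0 < B ∧
      Filter.Tendsto (fun n : ℕ => HarmonicDesign.fisherBound n (2 * e) / (n : ℝ) ^ e)
        Filter.atTop (nhds B)) := by
  exact ⟨HarmonicDesign.eventually_not_isTightDesign he,
    fun _ hn _ hY => hY.equiangular hn (by lia),
    HarmonicDesign.tendsto_fisherBound_div (by lia)⟩
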